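/- Let $(E,d)$ be a metric space equipped with its Borel $\sigma$-algebra $\mathcal E$, and let $X_1, X_2, \dots, X$ be random elements of $(E,\mathcal E)$ (each defined on its own probability space). Suppose that $X$ takes values almost surely in a separable subset $E_0 \in \mathcal E$. Then $X_n \to X$ in distribution as $n\to\infty$, that is, $\int h \, dP_n \to \int h \, dP$ for every bounded continuous $h : E \to \mathbb R$, where $P_n$ and $P$ are the distributions of $X_n$ and $X$, if and only if there exist a probability space and random elements $\hat X_1, \hat X_2, \dots, \hat X$ of $(E,\mathcal E)$, all defined on it, with distributions $P_1, P_2, \dots, P$ respectively, such that $\hat X_n \to \hat X$ pointwise, that is, $d(\hat X_n(\omega), \hat X(\omega)) \to 0$ as $n\to\infty$ for every $\omega$ in that space. -/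

import Mathlib

open MeasureTheory Filter Topology

universe u v w t

/-- A coupling `(X̂₀, X̂₁, …, X̂)` of the random elements `X₀, X₁, …, X` (which may live on
different probability spaces): random elements on one common space, carrying the measure `ν`,
with the same marginal distributions. (`ν` is a probability measure wherever this is used.) -/
structure IsCoupling {E : Type u} [MeasurableSpace E]
    {Ω : ℕ → Type v} [∀ n, MeasurableSpace (Ω n)] (μ : ∀ n, Measure (Ω n)) (X : ∀ n, Ω n → E)
    {Ω' : Type w} [MeasurableSpace Ω'] (μ' : Measure Ω') (X' : Ω' → E)
    {S : Type t} [MeasurableSpace S] (ν : Measure S) (Y : ℕ → S → E) (Y' : S → E) : Prop where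
  measurable_seq : ∀ n, Measurable (Y n)
  measurable_limit : Measurable Y'
  map_seq : ∀ n, ν.map (Y n) = (μ n).map (X n)
  map_limit : ν.map Y' = μ'.map X'

/-! Cut `E` at level `m` into finitely many `P`-continuity cells of diameter below `2⁻ᵐ`, plus one
bad cell of mass at most `2⁻ᵐ`. Weak convergence gives, for a fixed factor `a < 1`, that `Q n`
eventually charges each cell at least `a` times as much as `P`, so `Q n` is a mixture of a remainder
and of laws living on the cells. Take `X̂` of law `P` and an independent geometric `ξ`; let `m n →
∞` slowly. If `ξ < m n`, draw `Ŷₙ` from the cell of `X̂`, otherwise from the remainder. A single `ξ`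
serves all `n`, so eventually `ξ < m n`, and Borel–Cantelli removes the bad cells. The converse is
that almost sure convergence implies convergence in distribution. -/

open scoped ENNReal

/-! ### Mixtures and random selection -/

/-- A probability measure `Q` whose cells `{I = i}` have mass at least `q (i + 1)` is the mixture,
with weights `q`, of probability measures of which the `(i + 1)`-st sits on the cell `{I = i}`. -/
theorem exists_mixture_of_le_cells {E : Type*} [MeasurableSpace E] (Q : Measure E)
    [IsProbabilityMeasure Q] {I : E → ℕ} (hI : Measurable I) (q : ℕ → ℝ≥0∞)
    (hq : ∑' j, q j = 1) (hq0 : q 0 ≠ 0) (hle : ∀ i, q (i + 1) ≤ Q (I ⁻¹' {i})) :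
    ∃ ρ : ℕ → Measure E, (∀ j, IsProbabilityMeasure (ρ j)) ∧
      (∀ i, q (i + 1) ≠ 0 → ∀ᵐ x ∂ρ (i + 1), I x = i) ∧
      ∀ s, MeasurableSet s → Q s = ∑' j, q j * ρ j s := by
  classical
  have hm (i : ℕ) : MeasurableSet (I ⁻¹' {i}) := hI (measurableSet_singleton i)
  have hdecomp (s : Set E) (hs : MeasurableSet s) : Q s = ∑' i, Q (I ⁻¹' {i} ∩ s) := by
    have := tsum_measure_preimage_singleton (μ := Q.restrict s) (f := I) Set.countable_univ
      fun i _ => hm i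
    rw [tsum_univ (f := fun i => Q.restrict s (I ⁻¹' {i}))] at this
    simp_rw [Measure.restrict_apply (hm _)] at this
    simpa using this.symm
  let σ : ℕ → Measure E := fun i =>
    if Q (I ⁻¹' {i}) = 0 then Q else ProbabilityTheory.cond Q (I ⁻¹' {i})
  have hσ (i : ℕ) : IsProbabilityMeasure (σ i) := by
    by_cases h : Q (I ⁻¹' {i}) = 0
    · simp only [σ, if_pos h]; infer_instance
    · simp only [σ, if_neg h]; exact ProbabilityTheory.cond_isProbabilityMeasure h
  have hσQ (i : ℕ) (s : Set E) : Q (I ⁻¹' {i}) * σ i s = Q (I ⁻¹' {i} ∩ s) := by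
    by_cases h : Q (I ⁻¹' {i}) = 0
    · rw [h, zero_mul, measure_mono_null Set.inter_subset_left h]
    · simp only [σ, if_neg h]
      rw [mul_comm, ProbabilityTheory.cond_mul_eq_inter (hm i)]
  have hq0top : q 0 ≠ ∞ := ne_top_of_le_ne_top ENNReal.one_ne_top (hq ▸ ENNReal.le_tsum 0)
  let r : ℕ → ℝ≥0∞ := fun i => Q (I ⁻¹' {i}) - q (i + 1)
  have hr (i : ℕ) : r i + q (i + 1) = Q (I ⁻¹' {i}) := tsub_add_cancel_of_le (hle i)
  have hsplit : q 0 + ∑' i, q (i + 1) = 1 := by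
    exact (tsum_eq_zero_add' ENNReal.summable).symm.trans hq
  have hrsum : ∑' i, r i = q 0 := by
    have h1 : ∑' i, r i + ∑' i, q (i + 1) = 1 := by
      rw [← ENNReal.tsum_add]; simp_rw [hr]
      have := hdecomp Set.univ MeasurableSet.univ
      simpa using this.symm
    have hfin : ∑' i, q (i + 1) ≠ ∞ := by
      refine ne_top_of_le_ne_top ENNReal.one_ne_top (hsplit ▸ le_add_self)
    exact (ENNReal.add_left_inj hfin).1 (h1.trans hsplit.symm)
  -- The mass left over in the cells totals `q 0`, so this normalises it.
  let τ : Measure E := (q 0)⁻¹ • Measure.sum fun i => r i • σ i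
  have hτ (s : Set E) (hs : MeasurableSet s) : q 0 * τ s = ∑' i, r i * σ i s := by
    simp only [τ, Measure.smul_apply, Measure.sum_apply _ hs, smul_eq_mul]
    rw [← mul_assoc, ENNReal.mul_inv_cancel hq0 hq0top, one_mul]
  have hτp : IsProbabilityMeasure τ := by
    constructor
    have := hτ Set.univ MeasurableSet.univ
    simp only [measure_univ, mul_one, hrsum] at this
    exact (ENNReal.mul_right_inj hq0 hq0top).1 (this.trans (mul_one _).symm)
  refine ⟨fun j => Nat.casesOn j τ σ, ?_, ?_, ?_⟩
  · rintro (_ | i)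
    exacts [hτp, hσ i]
  · intro i hi
    have h : Q (I ⁻¹' {i}) ≠ 0 := fun h => hi (le_zero_iff.1 (h ▸ hle i))
    simp only [σ, if_neg h]
    exact ProbabilityTheory.ae_cond_mem (hm i)
  · intro s hs
    rw [tsum_eq_zero_add' ENNReal.summable]
    change Q s = q 0 * τ s + ∑' i, q (i + 1) * σ i s
    rw [hτ s hs, ← ENNReal.tsum_add, hdecomp s hs]
    refine tsum_congr fun i => ?_
    rw [← add_mul, hr, hσQ]

/-- Selecting a coordinate of an independent family by an independent random index
produces the mixture of the marginals. -/
theorem prod_infinitePi_selection {Z ι E : Type*} [MeasurableSpace Z] [MeasurableSpace E]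
    (ν : Measure Z) [SFinite ν] (ρ : ι → ℕ → Measure E) [∀ n j, IsProbabilityMeasure (ρ n j)]
    {J : Z → ℕ} (hJ : Measurable J) (n : ι) {s : Set E} (hs : MeasurableSet s) :
    ν.prod (Measure.infinitePi fun p : ι × ℕ => ρ p.1 p.2) {x | x.2 (n, J x.1) ∈ s} =
      ∑' j, ν (J ⁻¹' {j}) * ρ n j s := by
  have hset : {x : Z × (ι × ℕ → E) | x.2 (n, J x.1) ∈ s} =
      ⋃ j, (J ⁻¹' {j}) ×ˢ (Function.eval (n, j) ⁻¹' s) := by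
    ext x; simp
  rw [hset, measure_iUnion]
  · refine tsum_congr fun j => ?_
    rw [Measure.prod_prod, (measurePreserving_eval_infinitePi
      (fun p : ι × ℕ => ρ p.1 p.2) (n, j)).measure_preimage hs.nullMeasurableSet]
  · intro i j hij
    refine Set.disjoint_prod.2 (Or.inl ?_)
    exact Disjoint.preimage _ (by simpa using hij)
  · exact fun j => (hJ (measurableSet_singleton j)).prod (measurable_pi_apply _ hs)

theorem measurable_selection {Z ι E : Type*} [MeasurableSpace Z] [MeasurableSpace E]
    {J : Z → ℕ} (hJ : Measurable J) (n : ι) :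
    Measurable fun x : Z × (ι × ℕ → E) => x.2 (n, J x.1) := by
  intro s hs
  have hset : (fun x : Z × (ι × ℕ → E) => x.2 (n, J x.1)) ⁻¹' s =
      ⋃ j, (J ⁻¹' {j}) ×ˢ (Function.eval (n, j) ⁻¹' s) := by
    ext x; simp
  rw [hset]
  exact .iUnion fun j => (hJ (measurableSet_singleton j)).prod (measurable_pi_apply _ hs)

/-! ### Partitions into continuity sets -/

theorem eventually_mem_iff_of_notMem_frontier {X : Type*} [TopologicalSpace X] {s : Set X} {x : X}
    (hx : x ∉ frontier s) : ∀ᶠ y in 𝓝 x, (y ∈ s ↔ x ∈ s) := by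
  by_cases hxs : x ∈ s
  · have : x ∈ interior s := by
      by_contra h
      exact hx ⟨subset_closure hxs, h⟩
    filter_upwards [mem_interior_iff_mem_nhds.1 this] with y hy
    exact iff_of_true hy hxs
  · have : x ∉ closure s := fun h => hx ⟨h, fun h' => hxs (interior_subset h')⟩
    filter_upwards [isClosed_closure.isOpen_compl.mem_nhds this] with y hy
    exact iff_of_false (fun h => hy (subset_closure h)) hxs

theorem notMem_frontier_of_eventually_mem_iff {X : Type*} [TopologicalSpace X] {s : Set X} {x : X}
    (h : ∀ᶠ y in 𝓝 x, (y ∈ s ↔ x ∈ s)) : x ∉ frontier s := by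
  intro hx
  by_cases hxs : x ∈ s
  · exact hx.2 (mem_interior_iff_mem_nhds.2 (h.mono fun y hy => hy.2 hxs))
  · obtain ⟨y, hy, hys⟩ := mem_closure_iff_nhds.1 hx.1 _ h
    exact hxs (hy.1 hys)

theorem findGreatest_congr {p q : ℕ → Prop} [DecidablePred p] [DecidablePred q] {k : ℕ}
    (h : ∀ j ≤ k, (p j ↔ q j)) : Nat.findGreatest p k = Nat.findGreatest q k := by
  induction k with
  | zero => rfl
  | succ k ih =>
    rw [Nat.findGreatest_succ, Nat.findGreatest_succ, ih fun j hj => h j (hj.trans k.le_succ)]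
    simp only [h (k + 1) le_rfl]

/-- A probability measure carried by a separable set admits finite partitions into
continuity sets, all of them of small diameter except one of small mass. -/
theorem exists_partition_null_frontier {E : Type*} [PseudoMetricSpace E] [MeasurableSpace E]
    [BorelSpace E] (P : Measure E) [IsProbabilityMeasure P] {E₀ : Set E}
    (hsep : TopologicalSpace.IsSeparable E₀) (hP : ∀ᵐ x ∂P, x ∈ E₀)
    {δ : ℝ} (hδ : 0 < δ) {η : ℝ≥0∞} (hη : η ≠ 0) :
    ∃ (I : E → ℕ) (k : ℕ), Measurable I ∧ (∀ x, I x ≤ k) ∧ P (I ⁻¹' {0}) ≤ η ∧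
      (∀ x y, I x = I y → I x ≠ 0 → dist x y < δ) ∧ ∀ i, P (frontier (I ⁻¹' {i})) = 0 := by
  classical
  obtain ⟨C, hC, hEC⟩ := hsep
  have hCne : C.Nonempty := by
    obtain ⟨x, hx⟩ := hP.exists
    exact closure_nonempty_iff.1 ⟨x, hEC hx⟩
  obtain ⟨c, rfl⟩ := hC.exists_eq_range hCne
  -- Radii above `δ / 4` make the balls cover `closure (range c)`; radii below `δ / 2` keep
  -- diameters below `δ`. The shift `j - 1` frees index `0` for points outside the chosen balls.
  have hr (j : ℕ) := exists_null_frontier_thickening P {c (j - 1)} (half_lt_self (half_pos hδ))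
  choose r hrI hr0 using hr
  let B : ℕ → Set E := fun j => Metric.thickening (r j) {c (j - 1)}
  have hB (j : ℕ) : B j = Metric.ball (c (j - 1)) (r j) := Metric.thickening_singleton _ _
  have hBo (j : ℕ) : IsOpen (B j) := Metric.isOpen_thickening
  have hcover : ∀ᵐ x ∂P, ∃ j, 0 < j ∧ x ∈ B j := by
    filter_upwards [hP] with x hx
    obtain ⟨_, ⟨j, rfl⟩, hj⟩ := Metric.mem_closure_iff.1 (hEC hx) (δ / 2 / 2) (by positivity)
    refine ⟨j + 1, j.succ_pos, ?_⟩
    rw [hB]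
    exact hj.trans (hrI (j + 1)).1
  let S : ℕ → Set E := fun k => {x | ∀ j, 0 < j → j ≤ k → x ∉ B j}
  have hSm (k : ℕ) : MeasurableSet (S k) := by
    simp only [S, Set.ofPred_forall]
    exact .iInter fun j => .iInter fun _ => .iInter fun _ => (hBo j).measurableSet.compl
  have hlim : Tendsto (fun k => P (S k)) atTop (𝓝 0) := by
    have hanti : Antitone S := fun a b hab x hx j hj hja => hx j hj (hja.trans hab)
    have h0 : P (⋂ k, S k) = 0 := by
      refine measure_mono_null ?_ (ae_iff.1 hcover)
      rintro x hx ⟨j, hj, hxj⟩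
      exact Set.mem_iInter.1 hx j j hj le_rfl hxj
    rw [← h0]
    exact tendsto_measure_iInter_atTop (fun k => (hSm k).nullMeasurableSet) hanti
      ⟨0, measure_ne_top _ _⟩
  obtain ⟨k, hk⟩ := (hlim.eventually_le_const (pos_iff_ne_zero.2 hη)).exists
  refine ⟨fun x => Nat.findGreatest (fun j => x ∈ B j) k, k, ?_, ?_, ?_, ?_, ?_⟩
  · exact measurable_findGreatest fun j _ => (hBo j).measurableSet
  · exact fun x => Nat.findGreatest_le k
  · refine (measure_mono fun x hx j hj hjk hxj => ?_).trans hk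
    have := Nat.le_findGreatest (P := fun j => x ∈ B j) hjk hxj
    simp only [Set.mem_preimage, Set.mem_singleton_iff] at hx
    omega
  · intro x y hxy hx
    beta_reduce at hxy hx
    have h1 := Nat.findGreatest_of_ne_zero (P := fun j => x ∈ B j) rfl hx
    have h2 := Nat.findGreatest_of_ne_zero (P := fun j => y ∈ B j) rfl (hxy ▸ hx)
    rw [hB, Metric.mem_ball] at h1 h2
    rw [← hxy] at h2
    have := (hrI (Nat.findGreatest (fun j => x ∈ B j) k)).2
    have := dist_triangle_right x y (c (Nat.findGreatest (fun j => x ∈ B j) k - 1))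
    linarith
  · intro i
    -- Off all the frontiers, membership in each ball is locally constant, hence so is the index.
    have hsub : frontier ((fun x => Nat.findGreatest (fun j => x ∈ B j) k) ⁻¹' {i}) ⊆
        ⋃ j, frontier (B j) := by
      intro x hx
      by_contra hcon
      simp only [Set.mem_iUnion, not_exists] at hcon
      refine notMem_frontier_of_eventually_mem_iff ?_ hx
      have : ∀ᶠ y in 𝓝 x, ∀ j ∈ Finset.range (k + 1), (y ∈ B j ↔ x ∈ B j) :=
        (Filter.eventually_all_finset _).2 fun j _ =>
          eventually_mem_iff_of_notMem_frontier (hcon j)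
      filter_upwards [this] with y hy
      simp only [Set.mem_preimage, Set.mem_singleton_iff]
      rw [findGreatest_congr fun j hj => hy j (Finset.mem_range.2 (Nat.lt_succ_of_le hj))]
    exact measure_mono_null hsub (measure_iUnion_null hr0)

/-- Under weak convergence, the masses of finitely many continuity cells are eventually
almost as large as in the limit. -/
theorem eventually_mul_le_cells {E : Type*} [TopologicalSpace E] [MeasurableSpace E]
    [OpensMeasurableSpace E] [HasOuterApproxClosed E] {P : ProbabilityMeasure E}
    {Q : ℕ → ProbabilityMeasure E} (h : Tendsto Q atTop (𝓝 P)) {I : E → ℕ} {k : ℕ}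
    (hk : ∀ x, I x ≤ k) (hfr : ∀ i, (P : Measure E) (frontier (I ⁻¹' {i})) = 0)
    {a : ℝ≥0∞} (ha : a < 1) :
    ∀ᶠ n in atTop, ∀ i, a * (P : Measure E) (I ⁻¹' {i}) ≤ (Q n : Measure E) (I ⁻¹' {i}) := by
  have h1 : ∀ᶠ n in atTop, ∀ i ∈ Finset.range (k + 1),
      a * (P : Measure E) (I ⁻¹' {i}) ≤ (Q n : Measure E) (I ⁻¹' {i}) := by
    refine (Filter.eventually_all_finset _).2 fun i _ => ?_
    by_cases h0 : (P : Measure E) (I ⁻¹' {i}) = 0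
    · simp [h0]
    · refine (ProbabilityMeasure.tendsto_measure_of_null_frontier_of_tendsto' h
        (hfr i)).eventually_const_le ?_
      calc a * (P : Measure E) (I ⁻¹' {i}) < 1 * (P : Measure E) (I ⁻¹' {i}) :=
            ENNReal.mul_lt_mul_left h0 (measure_ne_top _ _) ha
        _ = _ := one_mul _
  filter_upwards [h1] with n hn i
  by_cases hi : i ≤ k
  · exact hn i (Finset.mem_range.2 (Nat.lt_succ_of_le hi))
  · have : I ⁻¹' {i} = ∅ := by
      ext x
      simp only [Set.mem_preimage, Set.mem_singleton_iff, Set.mem_empty_iff_false, iff_false]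
      exact fun hx => hi (hx ▸ hk x)
    simp [this]

/-- Diagonal choice: a sequence of eventual properties, the first of which always holds,
holds along some index sequence growing to infinity. -/
theorem exists_tendsto_atTop_of_forall_eventually {p : ℕ → ℕ → Prop} (h0 : ∀ n, p 0 n)
    (h : ∀ m, ∀ᶠ n in atTop, p m n) : ∃ m : ℕ → ℕ, Tendsto m atTop atTop ∧ ∀ n, p (m n) n := by
  classical
  refine ⟨fun n => Nat.findGreatest (fun m => p m n) n, ?_, fun n => ?_⟩
  · refine tendsto_atTop.2 fun b => ?_
    filter_upwards [h b, eventually_ge_atTop b] with n hn hbn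
    exact Nat.le_findGreatest hbn hn
  · exact Nat.findGreatest_spec (P := fun m => p m n) (Nat.zero_le n) (h0 n)

/-! ### Construction of the coupling -/

/-- **Skorokhod's representation theorem** for laws on a metric space whose limit is carried by a
separable set. -/
theorem exists_forall_tendsto_of_tendsto {E : Type u} [PseudoMetricSpace E] [MeasurableSpace E]
    [BorelSpace E] {P : ProbabilityMeasure E} {Q : ℕ → ProbabilityMeasure E}
    (h : Tendsto Q atTop (𝓝 P)) {E₀ : Set E} (hsep : TopologicalSpace.IsSeparable E₀)
    (hP : ∀ᵐ x ∂(P : Measure E), x ∈ E₀) :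
    ∃ (S : Type u) (_ : MeasurableSpace S) (ν : Measure S) (_ : IsProbabilityMeasure ν)
      (Y : ℕ → S → E) (Y' : S → E), (∀ n, Measurable (Y n)) ∧ Measurable Y' ∧
        (∀ n, ν.map (Y n) = Q n) ∧ ν.map Y' = P ∧
        ∀ s, Tendsto (fun n => Y n s) atTop (𝓝 (Y' s)) := by
  classical
  obtain ⟨e₀, -⟩ := hP.exists
  -- Only `G (Set.Iio m) < 1` and the positivity of tails matter.
  let G : Measure ℕ := ProbabilityTheory.geometricMeasure ⟨1 / 2, by norm_num, by norm_num⟩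
  have hG (k : ℕ) : G {k} ≠ 0 := by
    have := ProbabilityTheory.geometricMeasure_real_singleton_pos
      (p := ⟨1 / 2, by norm_num, by norm_num⟩) (by simp [Subtype.ext_iff])
      (by simp [Subtype.ext_iff]) k
    exact fun h0 => this.ne' (by simp only [Measure.real, G] at h0 ⊢; rw [h0]; rfl)
  have hGprob : IsProbabilityMeasure G := by infer_instance
  have hGIci (m : ℕ) : G (Set.Ici m) ≠ 0 := fun h0 =>
    hG m (measure_mono_null (by simp) h0)
  have hGIio (m : ℕ) : G (Set.Iio m) < 1 := by
    have h1 := prob_add_prob_compl (μ := G) (s := Set.Iio m) measurableSet_Iio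
    rw [Set.compl_Iio] at h1
    rw [← h1]
    exact ENNReal.lt_add_right (measure_ne_top _ _) (hGIci m)
  have hpart (m : ℕ) := exists_partition_null_frontier (P : Measure E) hsep hP
    (δ := (1 / 2 : ℝ) ^ m) (by positivity) (η := (2⁻¹ : ℝ≥0∞) ^ m) (by simp)
  choose I k hI hIk hI0 hId hIfr using hpart
  obtain ⟨m, hm, hle⟩ := exists_tendsto_atTop_of_forall_eventually
    (p := fun m n => ∀ i, G (Set.Iio m) * (P : Measure E) (I m ⁻¹' {i}) ≤
      (Q n : Measure E) (I m ⁻¹' {i}))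
    (fun n i => by simp) (fun m => eventually_mul_le_cells h (hIk m) (hIfr m) (hGIio m))
  -- Index `0` selects the remainder, `i + 1` the law on cell `i`.
  let J : ℕ → E × ℕ → ℕ := fun n z => if z.2 < m n then I (m n) z.1 + 1 else 0
  have hJ (n : ℕ) : Measurable (J n) :=
    Measurable.ite (measurable_snd measurableSet_Iio)
      ((measurable_of_countable (· + 1)).comp ((hI (m n)).comp measurable_fst)) measurable_const
  let ν₀ : Measure (E × ℕ) := (P : Measure E).prod G
  have hJsucc (n i : ℕ) : ν₀ (J n ⁻¹' {i + 1}) =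
      G (Set.Iio (m n)) * (P : Measure E) (I (m n) ⁻¹' {i}) := by
    have : J n ⁻¹' {i + 1} = (I (m n) ⁻¹' {i}) ×ˢ Set.Iio (m n) := by
      ext z
      by_cases hz : z.2 < m n <;> simp [J, hz]
    rw [this, Measure.prod_prod, mul_comm]
  have hJzero (n : ℕ) : ν₀ (J n ⁻¹' {0}) ≠ 0 := by
    have : J n ⁻¹' {0} = Set.univ ×ˢ Set.Ici (m n) := by
      ext z
      by_cases hz : z.2 < m n
      · simp [J, hz]
      · simp [J, hz, not_lt.1 hz]
    rw [this, Measure.prod_prod, measure_univ, one_mul]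
    exact hGIci _
  have hmix (n : ℕ) := exists_mixture_of_le_cells (Q n : Measure E) (hI (m n))
    (fun j => ν₀ (J n ⁻¹' {j}))
    (by
      have := tsum_measure_preimage_singleton (μ := ν₀) (f := J n) Set.countable_univ
        fun i _ => hJ n (measurableSet_singleton i)
      rw [tsum_univ (f := fun i => ν₀ (J n ⁻¹' {i}))] at this
      simpa using this)
    (hJzero n) (fun i => (hJsucc n i).trans_le (hle n i))
  choose ρ hρ hρI hρQ using hmix
  let π : Measure (ℕ × ℕ → E) := Measure.infinitePi fun p : ℕ × ℕ => ρ p.1 p.2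
  let ν : Measure ((E × ℕ) × (ℕ × ℕ → E)) := ν₀.prod π
  let Y : ℕ → (E × ℕ) × (ℕ × ℕ → E) → E := fun n x => x.2 (n, J n x.1)
  have hY (n : ℕ) : Measurable (Y n) := measurable_selection (hJ n) n
  have hYlaw (n : ℕ) : ν.map (Y n) = Q n := by
    ext s hs
    rw [Measure.map_apply (hY n) hs, hρQ n s hs]
    exact prod_infinitePi_selection ν₀ ρ (hJ n) n hs
  have hY'law : ν.map (fun x => x.1.1) = P := by
    have h1 : MeasurePreserving (Prod.fst : E × ℕ → E) ν₀ P := measurePreserving_fst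
    have h2 : MeasurePreserving (Prod.fst : (E × ℕ) × (ℕ × ℕ → E) → E × ℕ) ν ν₀ :=
      measurePreserving_fst
    exact (h1.comp h2).map_eq
  have hcells : ∀ᵐ x ∂ν, ∀ n i, ν₀ (J n ⁻¹' {i + 1}) ≠ 0 → I (m n) (x.2 (n, i + 1)) = i := by
    refine Measure.quasiMeasurePreserving_snd.ae (p := fun ω : ℕ × ℕ → E =>
      ∀ n i, ν₀ (J n ⁻¹' {i + 1}) ≠ 0 → I (m n) (ω (n, i + 1)) = i) ?_
    refine ae_all_iff.2 fun n => ae_all_iff.2 fun i => ?_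
    by_cases hi : ν₀ (J n ⁻¹' {i + 1}) = 0
    · simp [hi]
    · filter_upwards [(measurePreserving_eval_infinitePi (fun p : ℕ × ℕ => ρ p.1 p.2)
        (n, i + 1)).quasiMeasurePreserving.ae (hρI n i hi)] with ω hω _
      exact hω
  -- The component laws are known to sit on their cells only for indices of positive weight; almost
  -- surely no other index is selected.
  have hcharged : ∀ᵐ z ∂ν₀, ∀ n j, J n z = j → ν₀ (J n ⁻¹' {j}) ≠ 0 := by
    refine ae_all_iff.2 fun n => ae_all_iff.2 fun j => ?_
    by_cases hj : ν₀ (J n ⁻¹' {j}) = 0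
    · filter_upwards [measure_eq_zero_iff_ae_notMem.1 hj] with z hz hz'
      exact absurd hz' hz
    · exact .of_forall fun _ _ => hj
  have hgood : ∀ᵐ y ∂(P : Measure E), ∀ᶠ l in atTop, y ∉ I l ⁻¹' {0} := by
    refine ae_eventually_notMem (ne_top_of_le_ne_top ?_ (ENNReal.tsum_le_tsum hI0))
    rw [ENNReal.tsum_geometric]
    simp
  have hlim : ∀ᵐ x ∂ν, Tendsto (fun n => Y n x) atTop (𝓝 x.1.1) := by
    filter_upwards [hcells, Measure.quasiMeasurePreserving_fst.ae hcharged,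
      Measure.quasiMeasurePreserving_fst.ae (Measure.quasiMeasurePreserving_fst.ae hgood)]
      with x hx1 hx2 hx3
    refine tendsto_iff_dist_tendsto_zero.2 (squeeze_zero' (.of_forall fun _ => dist_nonneg) ?_
      ((tendsto_pow_atTop_nhds_zero_of_lt_one (r := (1 / 2 : ℝ)) (by norm_num)
        (by norm_num)).comp hm))
    filter_upwards [hm.eventually hx3, hm.eventually_gt_atTop x.1.2] with n hn0 hn
    have hJx : J n x.1 = I (m n) x.1.1 + 1 := if_pos hn
    have hYI : I (m n) (Y n x) = I (m n) x.1.1 := by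
      simp only [Y, hJx]
      exact hx1 n _ (hx2 n _ hJx)
    exact (hId (m n) _ _ hYI (by rw [hYI]; exact hn0)).le
  -- Making everything constant on a measurable null set turns almost sure convergence into
  -- pointwise convergence without changing the laws.
  obtain ⟨N, hN, hNm, hN0⟩ := exists_measurable_superset_of_null (ae_iff.1 hlim)
  refine ⟨_, inferInstance, ν, inferInstance, fun n => N.piecewise (fun _ => e₀) (Y n),
    N.piecewise (fun _ => e₀) (fun x => x.1.1), fun n => measurable_const.piecewise hNm (hY n),
    measurable_const.piecewise hNm (measurable_fst.comp measurable_fst), fun n => ?_, ?_,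
    fun x => ?_⟩
  · rw [← hYlaw n]
    refine Measure.map_congr ?_
    filter_upwards [measure_eq_zero_iff_ae_notMem.1 hN0] with x hx
    exact Set.piecewise_eq_of_notMem _ _ _ hx
  · rw [← hY'law]
    refine Measure.map_congr ?_
    filter_upwards [measure_eq_zero_iff_ae_notMem.1 hN0] with x hx
    exact Set.piecewise_eq_of_notMem _ _ _ hx
  · by_cases hx : x ∈ N
    · simp [hx, tendsto_const_nhds]
    · simp only [Set.piecewise_eq_of_notMem _ _ _ hx]
      by_contra hcon
      exact hx (hN hcon)

/-! ### The equivalence -/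

theorem theorem2 {E : Type u} [MetricSpace E] [MeasurableSpace E] [BorelSpace E]
    {Ω : ℕ → Type v} [∀ n, MeasurableSpace (Ω n)]
    (μ : ∀ n, Measure (Ω n)) [∀ n, IsProbabilityMeasure (μ n)]
    {Ω' : Type w} [MeasurableSpace Ω'] (μ' : Measure Ω') [IsProbabilityMeasure μ']
    (X : ∀ n, Ω n → E) (hX : ∀ n, Measurable (X n))
    (X' : Ω' → E) (hX' : Measurable X')
    (E₀ : Set E) (hE₀ : MeasurableSet E₀) (hsep : TopologicalSpace.IsSeparable E₀)
    (hmem : ∀ᵐ ω ∂μ', X' ω ∈ E₀) :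
    TendstoInDistribution X atTop X' μ μ' ↔
      ∃ (S : Type (max u t)) (_ : MeasurableSpace S) (ν : Measure S) (_ : IsProbabilityMeasure ν)
        (Y : ℕ → S → E) (Y' : S → E),
        IsCoupling μ X μ' X' ν Y Y' ∧ ∀ s, Tendsto (fun n => Y n s) atTop (𝓝 (Y' s)) := by
  constructor
  · intro h
    have hP : ∀ᵐ x ∂(μ'.map X'), x ∈ E₀ := (ae_map_iff hX'.aemeasurable hE₀).2 hmem
    obtain ⟨S, _, ν, _, Y, Y', hY, hY', hYm, hYm', hlim⟩ :=
      exists_forall_tendsto_of_tendsto h.tendsto hsep hP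
    have hup : Measurable (ULift.up.{t} : S → ULift.{t} S) := measurable_up
    have hdown : Measurable (ULift.down.{t} : ULift.{t} S → S) := measurable_down
    -- The constructed space lies in `Type u`; lifting reaches the required universe.
    refine ⟨ULift.{t} S, inferInstance, ν.map ULift.up,
      Measure.isProbabilityMeasure_map hup.aemeasurable, fun n => Y n ∘ ULift.down,
      Y' ∘ ULift.down, ⟨fun n => (hY n).comp hdown, hY'.comp hdown, fun n => ?_, ?_⟩,
      fun s => hlim s.down⟩
    · rw [Measure.map_map ((hY n).comp hdown) hup]
      exact hYm n
    · rw [Measure.map_map (hY'.comp hdown) hup]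
      exact hYm'
  · rintro ⟨S, _, ν, _, Y, Y', hc, hlim⟩
    have h := tendstoInDistribution_of_ae_tendsto (l := atTop) (μ' := ν)
      (fun n => (hc.measurable_seq n).aemeasurable) hc.measurable_limit.aemeasurable
      (ae_of_all _ hlim)
    refine ⟨fun n => (hX n).aemeasurable, hX'.aemeasurable, ?_⟩
    simpa only [hc.map_seq, hc.map_limit] using h.tendsto
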